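/- Let $0\le q\le r\le m$ be integers and $S=[m]$. Label $2^m$ qubits by the bit strings $x\in\mathbb{Z}_2^m$. For $J\subseteq S$ let $\langle J\rangle$ be the set of bit strings supported in $J$, and let $e_J$ be the indicator string of $J$; a coset $x+\langle J\rangle$ is a $|J|$-cube. For a set $A$ of vertices, $X_A$ and $Z_A$ act as the Pauli gate $X$, respectively $Z$, on each qubit of $A$ and as the identity elsewhere. The quantum Reed–Muller code $QRM_m(q,r)$ is the joint $+1$ eigenspace of all $X_A$ with $A$ an $(m-q)$-cube and all $Z_A$ with $A$ an $(r+1)$-cube. Its logical qubits are indexed by $\mathcal{Q}=\{J\subseteq S: q+1\le |J|\le r\}$, with logical Pauli operators $\overline{Z}_J=Z_{\langle J\rangle}$ and $\overline{X}_J=X_{e_J+\langle S\setminus J\rangle}$. An undetectable Pauli error is a product of the above stabilizers and logical Pauli operators. For $k\ge 0$ let $Z(k)=|0\rangle\langle 0|+e^{i\pi/2^k}|1\rangle\langle 1|$, and let $\widetilde{Z}(k)_A$ act as $Z(k)$ on the vertices of $A$ of even Hamming weight, as $Z(k)^\dagger$ on those of odd Hamming weight, and as the identity elsewhere. Let $\mathcal{Q}_k=\{K\subseteq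 S: q+kr+1\le |K|\le (k+1)r\}$. For $K\in\mathcal{Q}_k$, a minimal cover of $K$ is a set $\mathcal{J}\subseteq\mathcal{Q}$ with $\bigcup_{J\in\mathcal{J}}J=K$ and $|\mathcal{J}|=k+1$; let $\mathcal{F}(K)$ be the collection of all minimal covers of $K$. For a nonempty $\mathcal{J}\subseteq\mathcal{Q}$ let $\overline{C^{\mathcal{J}}Z}=I-2\prod_{J\in\mathcal{J}}\tfrac12(I-\overline{Z}_J)$, the logical gate that multiplies by $-1$ the logical computational basis states in which all the qubits of $\mathcal{J}$ are $1$ and fixes the others; $\overline{C^{\emptyset}Z}=I$. For a collection $\mathcal{F}$ of subsets of $\mathcal{Q}$ let $\overline{C^{\mathcal{F}}Z}=\prod_{\mathcal{J}\in\mathcal{F}}\overline{C^{\mathcal{J}}Z}$. Write $U\equiv V$ if $U|\psi\rangle=V|\psi\rangle$ and $UPU^\dagger|\psi\rangle=VPV^\dagger|\psi\rangle$ for every code state $|\psi\rangle$ and every undetectable Pauli error $P$. Theorem. Let $k_1,\dots,k_\ell$ be non-negative integers and let $K_1,\dots,K_\ell\subseteq S$ be distinct sets with $K_i\in\mathcal{Q}_{k_i}$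 for every $i$. Then $\prod_{i=1}^{\ell}\widetilde{Z}(k_i)_{\langle K_i\rangle}$ maps the code space of $QRM_m(q,r)$ into itself, and $$\prod_{i=1}^{\ell}\widetilde{Z}(k_i)_{\langle K_i\rangle}\equiv\overline{C^{\mathcal{F}}Z},\qquad \mathcal{F}=\bigcup_{i=1}^{\ell}\mathcal{F}(K_i).$$ Moreover no logical gates cancel in this product: every $\mathcal{J}\in\mathcal{F}$ is a minimal cover of exactly one of the $K_i$. -/

import Mathlib

noncomputable section

namespace QRM

/-- The vertices of the `m`-dimensional hypercube `ℤ₂^m`; they label the `2^m` physical qubits. -/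
abbrev Cube (m : ℕ) := Fin m → ZMod 2

/-- Computational basis labels of the `2^m`-qubit register: one bit for each vertex. -/
abbrev Config (m : ℕ) := Cube m → Fin 2

/-- State vectors of the `2^m`-qubit register `(ℂ²)^{⊗ 2^m}`, in the computational basis. -/
abbrev State (m : ℕ) := Config m → ℂ

/-- Operators on the `2^m`-qubit register, as matrices in the computational basis. -/
abbrev Op (m : ℕ) := Matrix (Config m) (Config m) ℂ

/-! ### Subcubes and transversal operators -/

/-- The subcube `x + ⟨J⟩`: the bit strings that agree with `x` outside of `J`. -/
def subcube {m : ℕ} (x : Cube m) (J : Finset (Fin m)) : Finset (Cube m) :=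
  Finset.univ.filter fun y => ∀ i, i ∉ J → y i = x i

/-- The standard subcube `⟨J⟩`: the bit strings supported in `J`. -/
def stdCube {m : ℕ} (J : Finset (Fin m)) : Finset (Cube m) := subcube 0 J

/-- The incidence bit string `e_J` of `J`. -/
def incidence {m : ℕ} (J : Finset (Fin m)) : Cube m := fun i => if i ∈ J then 1 else 0

/-- The tensor product `⨂ₓ U x` of single-qubit gates, one for each vertex `x`. -/
def tensorOp {m : ℕ} (U : Cube m → Matrix (Fin 2) (Fin 2) ℂ) : Op m :=
  Matrix.of fun f g => ∏ x, U x (f x) (g x)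

/-- The Pauli gate `X`. -/
def gateX : Matrix (Fin 2) (Fin 2) ℂ := !![0, 1; 1, 0]

/-- The gate `Z(k) = |0⟩⟨0| + exp(iπ/2^k) |1⟩⟨1|`; in particular `Z(0)` is the Pauli gate `Z`. -/
def gateZ (k : ℕ) : Matrix (Fin 2) (Fin 2) ℂ :=
  Matrix.diagonal ![1, Complex.exp (Complex.I * Real.pi / 2 ^ k)]

/-- `X_A`: the gate `X` on every qubit of `A`, the identity elsewhere. -/
def opX {m : ℕ} (A : Finset (Cube m)) : Op m :=
  tensorOp fun x => if x ∈ A then gateX else 1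

/-- `Z_A`: the gate `Z = Z(0)` on every qubit of `A`, the identity elsewhere. -/
def opZ {m : ℕ} (A : Finset (Cube m)) : Op m :=
  tensorOp fun x => if x ∈ A then gateZ 0 else 1

/-- The signed operator `Z̃(k)_A`: the gate `Z(k)` on the vertices of `A` of even Hamming weight,
its adjoint on the vertices of `A` of odd Hamming weight, the identity elsewhere. -/
def signedZ {m : ℕ} (k : ℕ) (A : Finset (Cube m)) : Op m :=
  tensorOp fun x =>
    if x ∈ A then (if Even (hammingNorm x) then gateZ k else (gateZ k).conjTranspose) else 1

/-! ### The quantum Reed--Muller code -/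

/-- The stabilizer generators of `QRM_m(q,r)`: `X_A` for all `(m-q)`-cubes `A`, and `Z_A` for all
`(r+1)`-cubes `A`. -/
def stabilizers (m q r : ℕ) : Set (Op m) :=
  {P | ∃ (x : Cube m) (J : Finset (Fin m)), J.card + q = m ∧ P = opX (subcube x J)} ∪
  {P | ∃ (x : Cube m) (J : Finset (Fin m)), J.card = r + 1 ∧ P = opZ (subcube x J)}

/-- The code space of `QRM_m(q,r)`: the joint `+1` eigenspace of the stabilizers. -/
def codeSpace (m q r : ℕ) : Submodule ℂ (State m) where
  carrier := {ψ | ∀ P ∈ stabilizers m q r, P.mulVec ψ = ψ}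
  add_mem' := by
    intro a b ha hb P hP
    rw [Matrix.mulVec_add, ha P hP, hb P hP]
  zero_mem' := by
    intro P _
    exact Matrix.mulVec_zero P
  smul_mem' := by
    intro c a ha P hP
    rw [Matrix.mulVec_smul, ha P hP]

/-- The index set `𝒬_k` of the `k`-th level logical operators. -/
def levelIndex (m q r k : ℕ) : Finset (Finset (Fin m)) :=
  Finset.univ.filter fun K => q + k * r + 1 ≤ K.card ∧ K.card ≤ (k + 1) * r

/-- The index set `𝒬` of the logical qubits. -/
def qubitIndex (m q r : ℕ) : Finset (Finset (Fin m)) :=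
  Finset.univ.filter fun J => q + 1 ≤ J.card ∧ J.card ≤ r

/-- The logical Pauli operator `Z` of the logical qubit `J`, acting on `⟨J⟩`. -/
def logicalZ {m : ℕ} (J : Finset (Fin m)) : Op m := opZ (stdCube J)

/-- The logical Pauli operator `X` of the logical qubit `J`, acting on `e_J + ⟨S \ J⟩`. -/
def logicalX {m : ℕ} (J : Finset (Fin m)) : Op m := opX (subcube (incidence J) Jᶜ)

/-- The undetectable Pauli errors, up to phases: the products of stabilizers and of logical Pauli
operators. -/
def undetectablePaulis (m q r : ℕ) : Submonoid (Op m) :=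
  Submonoid.closure
    (stabilizers m q r ∪ {P | ∃ J ∈ qubitIndex m q r, P = logicalZ J ∨ P = logicalX J})

/-- Logical equivalence of two operators on `QRM_m(q,r)`: they act in the same way on every code
state (with no phase left free), and they conjugate undetectable Pauli errors to operators that act
in the same way on every code state. -/
structure LogicallyEquivalent (m q r : ℕ) (U V : Op m) : Prop where
  action : ∀ ψ ∈ codeSpace m q r, U.mulVec ψ = V.mulVec ψ
  conj : ∀ P ∈ undetectablePaulis m q r, ∀ ψ ∈ codeSpace m q r,
    (U * P * U.conjTranspose).mulVec ψ = (V * P * V.conjTranspose).mulVec ψ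

/-! ### Logical multi-controlled-`Z` circuits -/

theorem tensorOp_diagonal {m : ℕ} (d : Cube m → Fin 2 → ℂ) :
    tensorOp (fun x => Matrix.diagonal (d x)) =
      Matrix.diagonal fun f : Config m => ∏ x, d x (f x) := by
  ext f g
  simp only [tensorOp, Matrix.of_apply]
  by_cases h : f = g
  · subst h
    simp
  · rw [Matrix.diagonal_apply_ne _ h]
    obtain ⟨x, hx⟩ := Function.ne_iff.mp h
    exact Finset.prod_eq_zero (Finset.mem_univ x) (Matrix.diagonal_apply_ne _ hx)

theorem logicalZ_commute {m : ℕ} (J J' : Finset (Fin m)) :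
    Commute (logicalZ J) (logicalZ J') := by
  have key : ∀ A : Finset (Cube m), ∃ d : Config m → ℂ, opZ A = Matrix.diagonal d := by
    intro A
    refine ⟨fun f => ∏ x, (if x ∈ A then ![1, Complex.exp (Complex.I * Real.pi / 2 ^ 0)]
        else (1 : Fin 2 → ℂ)) (f x), ?_⟩
    rw [← tensorOp_diagonal, opZ]
    congr 1
    funext x
    split_ifs
    · rfl
    · exact Matrix.diagonal_one.symm
  obtain ⟨d, hd⟩ := key (stdCube J)
  obtain ⟨d', hd'⟩ := key (stdCube J')
  simp only [logicalZ, hd, hd', Commute, SemiconjBy, Matrix.diagonal_mul_diagonal, mul_comm]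

/-- The logical projector `|1⟩⟨1|` on the logical qubit `J`: the projector onto the
`-1` eigenspace of its logical `Z`. -/
def logicalOne {m : ℕ} (J : Finset (Fin m)) : Op m := (1 / 2 : ℂ) • (1 - logicalZ J)

theorem logicalOne_commute {m : ℕ} (J J' : Finset (Fin m)) :
    Commute (logicalOne J) (logicalOne J') :=
  ((((Commute.one_right _).sub_right ((Commute.one_left _).sub_left
    (logicalZ_commute J J'))).smul_left _).smul_right _)

/-- The logical projector `|1⋯1⟩⟨1⋯1|` on the logical qubits in `𝒥`. -/
def logicalOnes {m : ℕ} (𝒥 : Finset (Finset (Fin m))) : Op m :=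
  𝒥.noncommProd logicalOne fun J _ J' _ _ => logicalOne_commute J J'

/-- The logical `𝒥`-controlled-`Z` gate: it multiplies by `-1` the logical computational basis
states in which all the logical qubits in `𝒥` are `1`, and fixes the other ones. For `𝒥 = {J}` it
is the logical `Z` of `J`, and for `𝒥 = ∅` it is the identity by convention. -/
def logicalCZ {m : ℕ} (𝒥 : Finset (Finset (Fin m))) : Op m :=
  if 𝒥 = ∅ then 1 else 1 - (2 : ℂ) • logicalOnes 𝒥

theorem logicalCZ_commute {m : ℕ} (𝒥 𝒥' : Finset (Finset (Fin m))) :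
    Commute (logicalCZ 𝒥) (logicalCZ 𝒥') := by
  have h : Commute (logicalOnes 𝒥) (logicalOnes 𝒥') :=
    Finset.noncommProd_commute _ _ _ _ fun J' _ =>
      (Finset.noncommProd_commute _ _ _ _ fun J _ => logicalOne_commute J' J).symm
  unfold logicalCZ
  split_ifs
  · exact Commute.one_left _
  · exact Commute.one_left _
  · exact Commute.one_right _
  · exact (Commute.one_right _).sub_right ((Commute.one_left _).sub_left
      ((h.smul_left _).smul_right _))

/-- The logical circuit `C^ℱ Z`: the product of the gates `C^𝒥 Z` for `𝒥 ∈ ℱ`. -/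
def logicalCircuit {m : ℕ} (ℱ : Finset (Finset (Finset (Fin m)))) : Op m :=
  ℱ.noncommProd logicalCZ fun 𝒥 _ 𝒥' _ _ => logicalCZ_commute 𝒥 𝒥'

/-- The collection `ℱ(K)` of the minimal covers of `K ∈ 𝒬_k`: the sets `𝒥 ⊆ 𝒬` of logical qubits
with union `K` and with exactly `k + 1` elements. -/
def minimalCovers (m q r k : ℕ) (K : Finset (Fin m)) : Finset (Finset (Finset (Fin m))) :=
  (qubitIndex m q r).powerset.filter fun 𝒥 => 𝒥.sup id = K ∧ 𝒥.card = k + 1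

end QRM

end

section

open Finset

/-! ### Combinatorics of set functions -/

/-! In the computational basis both sides are diagonal, and the `Z` stabilizers confine code states
to configurations `f` of degree at most `r`. Let `T` be the support of the algebraic normal form of
`f`: for a logical qubit `J`, membership in `T` says that the qubit is `1`.

The phase of `signedZ` is governed by the alternating sum of `f` over the subsets of `K`.
Substituting `f(s) = (1 - (-1)^n) / 2`, with `n` the number of members of `T` inside `s`, and
expanding `(-1)^n = (-2 + 1)^n`, inclusion-exclusion leaves only the subfamilies `𝒥` of `T` with
union exactly `K`, each weighted `±2^(#𝒥 - 1)` (`two_mul_alternating_sum`). Members have size at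
most `r` and `#K > k * r`, so `#𝒥 ≥ k + 1`; modulo `2^(k+1)` only covers with `k + 1` members
survive, each giving a phase `-1` (`signedZ_phase`). The bound `#K ≥ q + k * r + 1` makes their
members logical qubits.

Undetectable errors preserve the support condition, so agreement of the diagonals there suffices
(`logicallyEquivalent_diagonal`). -/

theorem sum_neg_one_pow_card_Icc {α : Type*} [DecidableEq α] (L K : Finset α) :
    ∑ s ∈ K.powerset with L ⊆ s, (-1 : ℤ) ^ s.card = if L = K then (-1) ^ K.card else 0 := by
  split_ifs with h
  · subst h
    rw [Finset.sum_eq_single L]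
    · intro s hs hne
      simp only [mem_filter, mem_powerset] at hs
      exact absurd (hs.1.antisymm hs.2) hne
    · simp
  · by_cases hLK : L ⊆ K
    -- Toggling an element of `K \ L` is a sign-reversing involution of the interval.
    · obtain ⟨i, hiK, hiL⟩ := Finset.exists_of_ssubset (hLK.ssubset_of_ne h)
      refine Finset.sum_involution (fun s _ => if i ∈ s then s.erase i else insert i s)
        ?_ ?_ ?_ ?_
      · intro s _
        by_cases hi : i ∈ s
        · rw [if_pos hi, ← Finset.card_erase_add_one hi, pow_succ]
          ring
        · rw [if_neg hi, Finset.card_insert_of_notMem hi, pow_succ]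
          ring
      · intro s _ _
        by_cases hi : i ∈ s
        · rw [if_pos hi]
          exact fun he => Finset.notMem_erase i s (he.ge hi)
        · rw [if_neg hi]
          exact fun he => hi (he ▸ Finset.mem_insert_self i s)
      · intro s hs
        simp only [mem_filter, mem_powerset] at hs ⊢
        by_cases hi : i ∈ s
        · rw [if_pos hi]
          exact ⟨(Finset.erase_subset _ _).trans hs.1, Finset.subset_erase.2 ⟨hs.2, hiL⟩⟩
        · rw [if_neg hi]
          exact ⟨Finset.insert_subset hiK hs.1, hs.2.trans (Finset.subset_insert _ _)⟩
      · intro s _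
        by_cases hi : i ∈ s <;> simp [hi]
    · apply Finset.sum_eq_zero
      intro s hs
      simp only [mem_filter, mem_powerset] at hs
      exact absurd (hs.2.trans hs.1) hLK

/-- After exchanging the sums, `F t` is counted once for each `J` between `t` and `s`. Modulo 2 the
signs of `sum_neg_one_pow_card_Icc` disappear, so this count is odd only for `t = s`. -/
theorem zmod_two_moebius_inversion {α : Type*} [DecidableEq α] (F : Finset α → ZMod 2)
    (s : Finset α) : ∑ J ∈ s.powerset, ∑ t ∈ J.powerset, F t = F s := by
  have h1 : ∑ J ∈ s.powerset, ∑ t ∈ J.powerset, F t =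
      ∑ t ∈ s.powerset, ∑ J ∈ s.powerset with t ⊆ J, F t := by
    refine Finset.sum_comm' ?_
    intro J t
    simp only [mem_powerset, mem_filter]
    exact ⟨fun h => ⟨⟨h.1, h.2⟩, h.2.trans h.1⟩, fun h => ⟨h.1.1, h.1.2⟩⟩
  have h2 (t : Finset α) : ∑ J ∈ s.powerset with t ⊆ J, F t = if t = s then F s else 0 := by
    have h3 := congrArg (Int.cast : ℤ → ZMod 2) (sum_neg_one_pow_card_Icc t s)
    have h4 : (-1 : ZMod 2) = 1 := rfl
    push_cast at h3
    simp only [h4, one_pow] at h3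
    rw [← mul_one (F t), ← Finset.mul_sum, h3]
    split_ifs with h
    · simp [h]
    · simp
  rw [h1, Finset.sum_congr rfl fun t _ => h2 t]
  simp

/-- An alternating sum of a Boolean function over the subsets of `K`, in terms of the support `T`
of its algebraic normal form. -/
theorem two_mul_alternating_sum {α : Type*} [DecidableEq α] (F : Finset α → ℕ)
    (T : Finset (Finset α)) (K : Finset α) (hK : K.Nonempty)
    (hF : ∀ s, (F s : ℤ) * 2 = 1 - (-1) ^ (T.filter (· ⊆ s)).card) :
    2 * ∑ s ∈ K.powerset, (-1 : ℤ) ^ s.card * F s =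
      -(-1) ^ K.card * ∑ 𝒥 ∈ T.powerset with 𝒥.sup id = K, (-2 : ℤ) ^ 𝒥.card := by
  -- Binomial expansion of `(-2 + 1)^n`; a family consists of subsets of `s` exactly when its union
  -- lies in `s`.
  have expand (s : Finset α) : (-1 : ℤ) ^ (T.filter (· ⊆ s)).card =
      ∑ 𝒥 ∈ T.powerset with 𝒥.sup id ⊆ s, (-2 : ℤ) ^ 𝒥.card := by
    have h := Finset.sum_pow_mul_eq_add_pow (-2 : ℤ) 1 (T.filter (· ⊆ s))
    simp only [one_pow, mul_one] at h
    rw [show (-1 : ℤ) = -2 + 1 by norm_num, ← h]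
    refine Finset.sum_congr ?_ fun _ _ => rfl
    ext 𝒥
    simp only [mem_powerset, mem_filter, Finset.subset_iff (s₁ := 𝒥),
      Finset.sup_le_iff, id]
    exact ⟨fun h => ⟨fun J hJ => (h hJ).1, fun J hJ => (h hJ).2⟩,
      fun h J hJ => ⟨h.1 hJ, h.2 J hJ⟩⟩
  have h0 : ∑ s ∈ K.powerset, (-1 : ℤ) ^ s.card = 0 :=
    Finset.sum_powerset_neg_one_pow_card_of_nonempty hK
  calc 2 * ∑ s ∈ K.powerset, (-1 : ℤ) ^ s.card * F s
      = ∑ s ∈ K.powerset, ((-1 : ℤ) ^ s.card -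
          ∑ 𝒥 ∈ T.powerset with 𝒥.sup id ⊆ s, (-2 : ℤ) ^ 𝒥.card * (-1) ^ s.card) := by
        rw [Finset.mul_sum]
        refine Finset.sum_congr rfl fun s _ => ?_
        rw [← Finset.sum_mul, ← expand, mul_left_comm, mul_comm 2, hF]
        ring
    _ = -∑ 𝒥 ∈ T.powerset, (-2 : ℤ) ^ 𝒥.card *
          ∑ s ∈ K.powerset with 𝒥.sup id ⊆ s, (-1 : ℤ) ^ s.card := by
        rw [Finset.sum_sub_distrib, h0, zero_sub]
        simp only [Finset.sum_filter, Finset.mul_sum]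
        rw [Finset.sum_comm]
        simp only [mul_ite, mul_zero]
    _ = _ := by
        simp only [sum_neg_one_pow_card_Icc]
        rw [Finset.sum_filter, Finset.mul_sum, ← Finset.sum_neg_distrib]
        refine Finset.sum_congr rfl fun 𝒥 _ => ?_
        split_ifs <;> ring

/-- The alternating sum modulo `2 ^ (k + 1)`, when only covers by at least `k + 1` sets occur. -/
theorem exists_alternating_sum_eq {α : Type*} [DecidableEq α] (F : Finset α → ℕ)
    (T : Finset (Finset α)) (K : Finset α) (hK : K.Nonempty) (k : ℕ)
    (hF : ∀ s, (F s : ℤ) * 2 = 1 - (-1) ^ (T.filter (· ⊆ s)).card)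
    (hT : ∀ 𝒥 ⊆ T, 𝒥.sup id = K → k + 1 ≤ 𝒥.card) :
    ∃ c : ℤ, ∑ s ∈ K.powerset, (-1 : ℤ) ^ s.card * F s =
      2 ^ k * ((#{𝒥 ∈ T.powerset | 𝒥.sup id = K ∧ 𝒥.card = k + 1} : ℕ) + 2 * c) := by
  have key : ∀ 𝒥 ∈ T.powerset.filter (fun 𝒥 => 𝒥.sup id = K), ∃ c : ℤ,
      -(-1) ^ K.card * (-2 : ℤ) ^ 𝒥.card =
        2 * (2 ^ k * ((if 𝒥.card = k + 1 then 1 else 0) + 2 * c)) := by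
    intro 𝒥 h𝒥
    rw [mem_filter, mem_powerset] at h𝒥
    obtain ⟨n, hn⟩ := Nat.exists_eq_add_of_le (hT 𝒥 h𝒥.1 h𝒥.2)
    -- The sign is odd either way, so it only affects the even remainder `2 * c`.
    have hsign : ∃ e : ℤ, -(-1) ^ K.card * (-2 : ℤ) ^ 𝒥.card = (1 + 2 * e) * 2 ^ 𝒥.card := by
      rw [show (-2 : ℤ) = -1 * 2 by norm_num, mul_pow, ← mul_assoc, neg_mul, ← pow_add]
      rcases neg_one_pow_eq_or ℤ (K.card + 𝒥.card) with h | h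
      · exact ⟨-1, by rw [h]; ring⟩
      · exact ⟨0, by rw [h]; ring⟩
    obtain ⟨e, he⟩ := hsign
    rw [he, hn]
    rcases n with _ | n
    · exact ⟨e, by simp; ring⟩
    · refine ⟨(1 + 2 * e) * 2 ^ n, ?_⟩
      rw [if_neg (by omega)]
      ring
  choose! c hc using key
  refine ⟨∑ 𝒥 ∈ T.powerset with 𝒥.sup id = K, c 𝒥, ?_⟩
  have h := two_mul_alternating_sum F T K hK hF
  rw [Finset.mul_sum _ _ (-(-1) ^ K.card : ℤ), Finset.sum_congr rfl hc, ← Finset.mul_sum,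
    ← Finset.mul_sum, Finset.sum_add_distrib, ← Finset.mul_sum] at h
  rw [mul_left_cancel₀ two_ne_zero h, ← Finset.sum_filter, Finset.filter_filter]
  simp

namespace QRM

variable {m q r : ℕ}

/-! ### Parities of configurations on subcubes -/

/-- The parity of the number of ones of `f` on `A`. -/
def parity (A : Finset (Cube m)) (f : Config m) : ZMod 2 := ∑ x ∈ A, ((f x : ℕ) : ZMod 2)

/-- The configuration obtained from `f` by flipping the bits in `A`. -/
def flip (A : Finset (Cube m)) (f : Config m) : Config m := fun x => if x ∈ A then f x + 1 else f x

/-- The Reed--Muller code of order `r`, as the set of the configurations that are even on all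
`(r + 1)`-cubes. -/
def reedMuller (m r : ℕ) : Set (Config m) :=
  {f | ∀ (x : Cube m) (J : Finset (Fin m)), J.card = r + 1 → parity (subcube x J) f = 0}

theorem mem_subcube {x y : Cube m} {J : Finset (Fin m)} :
    y ∈ subcube x J ↔ ∀ i, i ∉ J → y i = x i := by simp [subcube]

theorem flip_flip (A : Finset (Cube m)) (f : Config m) : flip A (flip A f) = f := by
  funext x
  simp only [flip]
  split_ifs
  · generalize f x = b
    revert b
    decide
  · rfl

theorem parity_flip (A B : Finset (Cube m)) (f : Config m) :
    parity B (flip A f) = parity B f + (#(B ∩ A) : ZMod 2) := by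
  have h (x : Cube m) : ((flip A f x : ℕ) : ZMod 2) =
      ((f x : ℕ) : ZMod 2) + if x ∈ A then 1 else 0 := by
    simp only [flip]
    split_ifs
    · generalize f x = b
      revert b
      decide
    · simp
  simp only [parity, h, Finset.sum_add_distrib, Finset.sum_boole, Finset.filter_mem_eq_inter]

/-- The two cubes share a direction `i`, and translation along `i` is a fixed-point-free involution
of their intersection. -/
theorem even_card_subcube_inter (x y : Cube m) (J K : Finset (Fin m)) (h : m < #J + #K) :
    Even #(subcube x J ∩ subcube y K) := by
  obtain ⟨i, hi⟩ : (J ∩ K).Nonempty := by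
    rw [← Finset.card_pos]
    have h1 := Finset.card_union_add_card_inter J K
    have h2 := Finset.card_le_univ (J ∪ K)
    rw [Fintype.card_fin] at h2
    omega
  rw [mem_inter] at hi
  have flipmem (z x : Cube m) (J : Finset (Fin m)) (hi : i ∈ J) (hz : z ∈ subcube x J) :
      z + Pi.single i 1 ∈ subcube x J := by
    rw [mem_subcube] at hz ⊢
    intro j hj
    have hji : j ≠ i := fun h => hj (h ▸ hi)
    simp [hji, hz j hj]
  have hsum : ∑ _z ∈ subcube x J ∩ subcube y K, (1 : ZMod 2) = 0 := by
    refine Finset.sum_involution (fun z _ => z + Pi.single i 1) ?_ ?_ ?_ ?_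
    · intros
      rfl
    · intro z _ _ hz
      have := congrFun hz i
      simp at this
    · intro z hz
      rw [mem_inter] at hz ⊢
      exact ⟨flipmem z x J hi.1 hz.1, flipmem z y K hi.2 hz.2⟩
    · intro z _
      rw [add_assoc, ← Pi.single_add, CharTwo.add_self_eq_zero, Pi.single_zero, add_zero]
  rw [Finset.sum_const, nsmul_eq_mul, mul_one] at hsum
  exact (ZMod.natCast_eq_zero_iff_even).1 hsum

theorem parity_flip_subcube (x y : Cube m) (J K : Finset (Fin m)) (h : m < #J + #K)
    (f : Config m) : parity (subcube x J) (flip (subcube y K) f) = parity (subcube x J) f := by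
  rw [parity_flip, (ZMod.natCast_eq_zero_iff_even).2 (even_card_subcube_inter x y J K h), add_zero]

theorem flip_mem_reedMuller (y : Cube m) (K : Finset (Fin m)) (h : m ≤ #K + r) {f : Config m}
    (hf : f ∈ reedMuller m r) : flip (subcube y K) f ∈ reedMuller m r := by
  intro x J hJ
  rw [parity_flip_subcube _ _ _ _ (by omega), hf x J hJ]

theorem parity_subcube_insert (x : Cube m) {J : Finset (Fin m)} {i : Fin m} (hi : i ∉ J)
    (f : Config m) : parity (subcube x (insert i J)) f =
      parity (subcube x J) f + parity (subcube (x + Pi.single i 1) J) f := by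
  have hd : Disjoint (subcube x J) (subcube (x + Pi.single i 1) J) := by
    rw [Finset.disjoint_left]
    intro y hy hy'
    have h := (mem_subcube.1 hy i hi).symm.trans (mem_subcube.1 hy' i hi)
    simp at h
  rw [parity, parity, parity, ← Finset.sum_union hd]
  congr 1
  ext y
  have two (a b : ZMod 2) : a = b ∨ a = b + 1 := by revert a b; decide
  rw [mem_union, mem_subcube, mem_subcube, mem_subcube]
  constructor
  · intro h
    refine (two (y i) (x i)).imp ?_ ?_ <;>
    · intro hyi j hj
      by_cases hji : j = i
      · subst hji
        simpa using hyi
      · simpa [hji] using h j (by simp [hji, hj])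
  · intro h j hj
    rw [mem_insert, not_or] at hj
    rcases h with h | h
    · exact h j hj.2
    · simpa [hj.1] using h j hj.2

/-- A larger cube splits into two parallel cubes of one dimension less, down to dimension `r + 1`.
-/
theorem parity_subcube_eq_zero {f : Config m} (hf : f ∈ reedMuller m r) (J : Finset (Fin m))
    (hJ : r < #J) (x : Cube m) : parity (subcube x J) f = 0 := by
  induction J using Finset.induction_on generalizing x with
  | empty => simp at hJ
  | insert i J hi ih =>
    rcases (Nat.succ_le_of_lt hJ).eq_or_lt with h | h
    · exact hf x _ h.symm
    · rw [card_insert_of_notMem hi] at h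
      have h' : r < #J := by omega
      rw [parity_subcube_insert x hi, ih h', ih h', add_zero]

theorem incidence_injective : Function.Injective (incidence (m := m)) := by
  intro s t h
  ext i
  have := congrFun h i
  simp only [incidence] at this
  by_cases hs : i ∈ s <;> by_cases ht : i ∈ t <;> simp_all

theorem stdCube_eq_map (J : Finset (Fin m)) :
    stdCube J = J.powerset.map ⟨incidence, incidence_injective⟩ := by
  ext y
  simp only [stdCube, mem_subcube, mem_map, mem_powerset, Function.Embedding.coeFn_mk,
    Pi.zero_apply]
  constructor
  · intro h
    refine ⟨univ.filter fun i => y i ≠ 0, ?_, ?_⟩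
    · intro i hi
      by_contra hiJ
      exact (mem_filter.1 hi).2 (h i hiJ)
    · funext i
      have two (a : ZMod 2) : (if a ≠ 0 then 1 else 0) = a := by revert a; decide
      simpa [incidence] using two (y i)
  · rintro ⟨s, hs, rfl⟩ i hi
    exact if_neg fun h => hi (hs h)

theorem hammingNorm_incidence (s : Finset (Fin m)) : hammingNorm (incidence s) = #s := by
  simp [hammingNorm, incidence]

/-- The support of the algebraic normal form of `f`: the logical qubits `J` with value `1`,
and the monomials of lower degree. -/
def anfSupport (f : Config m) : Finset (Finset (Fin m)) :=
  univ.filter fun J => parity (stdCube J) f ≠ 0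

theorem mem_anfSupport {f : Config m} {J : Finset (Fin m)} :
    J ∈ anfSupport f ↔ parity (stdCube J) f ≠ 0 :=
  Finset.mem_filter_univ J

theorem card_le_of_mem_anfSupport {f : Config m} (hf : f ∈ reedMuller m r) {J : Finset (Fin m)}
    (hJ : J ∈ anfSupport f) : #J ≤ r := by
  by_contra h
  exact mem_anfSupport.1 hJ (parity_subcube_eq_zero hf J (not_le.1 h) 0)

/-- By Möbius inversion the bit at `s` is the parity of the number of monomials of `f` inside `s`.
The `±1` form over `ℤ` is what the binomial expansion needs. -/
theorem val_incidence_mul_two (f : Config m) (s : Finset (Fin m)) :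
    ((f (incidence s) : ℕ) : ℤ) * 2 = 1 - (-1) ^ #{J ∈ anfSupport f | J ⊆ s} := by
  have h : ((f (incidence s) : ℕ) : ZMod 2) = (#{J ∈ anfSupport f | J ⊆ s} : ℕ) := by
    rw [← zmod_two_moebius_inversion (fun s => ((f (incidence s) : ℕ) : ZMod 2)) s]
    have h1 (J : Finset (Fin m)) : ∑ t ∈ J.powerset, ((f (incidence t) : ℕ) : ZMod 2) =
        if parity (stdCube J) f ≠ 0 then 1 else 0 := by
      have two (a : ZMod 2) : (if a ≠ 0 then 1 else 0) = a := by revert a; decide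
      rw [two, parity, stdCube_eq_map, Finset.sum_map]
      rfl
    rw [Finset.sum_congr rfl fun J _ => h1 J, Finset.sum_boole]
    congr 2
    ext J
    simp [anfSupport, and_comm]
  generalize #{J ∈ anfSupport f | J ⊆ s} = n at h ⊢
  generalize f (incidence s) = b at h ⊢
  fin_cases b
  · have : Even n := (ZMod.natCast_eq_zero_iff_even).1 (by simpa using h.symm)
    simp [this.neg_one_pow]
  · have : Odd n := (ZMod.natCast_eq_one_iff_odd).1 (by simpa using h.symm)
    simp [this.neg_one_pow]

/-! ### The gates in the computational basis -/

theorem opZ_eq_diagonal (A : Finset (Cube m)) :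
    opZ A = Matrix.diagonal fun f => if parity A f = 0 then 1 else -1 := by
  have h (x : Cube m) : (if x ∈ A then gateZ 0 else 1) =
      Matrix.diagonal fun b : Fin 2 => if x ∈ A then (-1 : ℂ) ^ (b : ℕ) else 1 := by
    split_ifs
    · rw [gateZ]
      congr 1
      funext b
      fin_cases b
      · simp
      · simp [mul_comm Complex.I, Complex.exp_pi_mul_I]
    · exact Matrix.diagonal_one.symm
  simp only [opZ, h, tensorOp_diagonal]
  congr 1
  funext f
  rw [Finset.prod_ite_mem, Finset.univ_inter, Finset.prod_pow_eq_pow_sum, parity, ← Nat.cast_sum]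
  split_ifs with he
  · exact ((ZMod.natCast_eq_zero_iff_even).1 he).neg_one_pow
  · rw [ZMod.natCast_eq_zero_iff_even, Nat.not_even_iff_odd] at he
    exact he.neg_one_pow

theorem opX_mulVec (A : Finset (Cube m)) (ψ : State m) (f : Config m) :
    (opX A).mulVec ψ f = ψ (flip A f) := by
  have h (g : Config m) : opX A f g = if g = flip A f then 1 else 0 := by
    have h1 (x : Cube m) : (if x ∈ A then gateX else 1 : Matrix (Fin 2) (Fin 2) ℂ) (f x) (g x) =
        if g x = flip A f x then 1 else 0 := by
      by_cases hx : x ∈ A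
      · simp only [flip, if_pos hx]
        generalize f x = a
        generalize g x = b
        fin_cases a <;> fin_cases b <;> simp [gateX]
      · simp only [flip, if_neg hx, Matrix.one_apply, eq_comm]
    simp only [opX, tensorOp, Matrix.of_apply, h1, Finset.prod_boole, mem_univ, forall_const,
      funext_iff]
  simp [Matrix.mulVec, dotProduct, h]

theorem signedZ_eq_diagonal (k : ℕ) (K : Finset (Fin m)) :
    signedZ k (stdCube K) = Matrix.diagonal fun f =>
      Complex.exp (Complex.I * Real.pi / 2 ^ k *
        (∑ s ∈ K.powerset, (-1 : ℤ) ^ #s * (f (incidence s) : ℕ) : ℤ)) := by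
  have h (x : Cube m) : (if x ∈ stdCube K then
      (if Even (hammingNorm x) then gateZ k else (gateZ k).conjTranspose) else 1) =
      Matrix.diagonal fun b : Fin 2 => if x ∈ stdCube K then
        Complex.exp (Complex.I * Real.pi / 2 ^ k * ((-1) ^ hammingNorm x * (b : ℕ))) else 1 := by
    split_ifs with hx he
    · rw [gateZ]
      congr 1
      funext b
      fin_cases b <;> simp [he.neg_one_pow]
    · rw [gateZ, Matrix.diagonal_conjTranspose]
      congr 1
      rw [Nat.not_even_iff_odd] at he
      funext b
      fin_cases b
      · simp
      · simp [he.neg_one_pow, ← Complex.exp_conj, neg_div, Complex.conj_ofNat]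
    · exact Matrix.diagonal_one.symm
  simp only [signedZ, h, tensorOp_diagonal]
  congr 1
  funext f
  rw [Finset.prod_ite_mem, Finset.univ_inter, ← Complex.exp_sum, ← Finset.mul_sum, stdCube_eq_map,
    Finset.sum_map]
  simp [hammingNorm_incidence]

theorem logicalOne_eq_diagonal (J : Finset (Fin m)) :
    logicalOne J = Matrix.diagonal fun f => if J ∈ anfSupport f then 1 else 0 := by
  rw [logicalOne, logicalZ, opZ_eq_diagonal, ← Matrix.diagonal_one, Matrix.diagonal_sub,
    ← Matrix.diagonal_smul]
  congr 1
  funext f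
  by_cases h : parity (stdCube J) f = 0
  · simp [anfSupport, h]
  · simp [anfSupport, h]
    norm_num

theorem noncommProd_diagonal {ι n : Type*} [DecidableEq n] [Fintype n] (s : Finset ι)
    (M : ι → Matrix n n ℂ) (d : ι → n → ℂ) (hd : ∀ i, M i = Matrix.diagonal (d i)) (comm) :
    s.noncommProd M comm = Matrix.diagonal (∏ i ∈ s, d i) := by
  obtain rfl : M = fun i => Matrix.diagonal (d i) := funext hd
  have h := Finset.map_noncommProd s d (fun _ _ _ _ _ => Commute.all _ _)
    (Matrix.diagonalRingHom n ℂ)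
  rw [Finset.noncommProd_eq_prod] at h
  exact h.symm

theorem logicalCZ_eq_diagonal (𝒥 : Finset (Finset (Fin m))) :
    logicalCZ 𝒥 = Matrix.diagonal fun f => if 𝒥 ≠ ∅ ∧ 𝒥 ⊆ anfSupport f then -1 else 1 := by
  rw [logicalCZ]
  split_ifs with h
  · simp [h]
  · have h1 : logicalOnes 𝒥 = _ := noncommProd_diagonal 𝒥 _ _ logicalOne_eq_diagonal _
    rw [h1, ← Matrix.diagonal_one,
      ← Matrix.diagonal_smul, Matrix.diagonal_sub]
    congr 1
    funext f
    simp only [Finset.prod_apply, Finset.prod_boole, Pi.smul_apply, smul_eq_mul, ne_eq, h,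
      not_false_eq_true, true_and, Finset.subset_iff]
    split_ifs <;> norm_num

theorem logicalCircuit_eq_diagonal (ℱ : Finset (Finset (Finset (Fin m)))) :
    logicalCircuit ℱ = Matrix.diagonal fun f =>
      ∏ 𝒥 ∈ ℱ, if 𝒥 ≠ ∅ ∧ 𝒥 ⊆ anfSupport f then -1 else 1 := by
  have h : logicalCircuit ℱ = _ := noncommProd_diagonal ℱ _ _ logicalCZ_eq_diagonal _
  rw [h]
  congr 1
  funext f
  rw [Finset.prod_apply]

/-! ### The phases of the gates on the Reed--Muller code -/

theorem nonempty_of_mem_levelIndex {k : ℕ} {K : Finset (Fin m)} (hK : K ∈ levelIndex m q r k) :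
    K.Nonempty := by
  simp only [levelIndex, mem_filter, mem_univ, true_and] at hK
  exact Finset.card_pos.1 (by omega)

theorem card_sup_le_mul (𝒥 : Finset (Finset (Fin m))) (h : ∀ J ∈ 𝒥, #J ≤ r) :
    #(𝒥.sup id) ≤ #𝒥 * r := by
  rw [Finset.sup_eq_biUnion]
  exact Finset.card_biUnion_le_card_mul _ _ _ h

theorem succ_le_card_of_sup_eq {k : ℕ} {K : Finset (Fin m)} (hK : K ∈ levelIndex m q r k)
    {𝒥 : Finset (Finset (Fin m))} (h𝒥 : ∀ J ∈ 𝒥, #J ≤ r) (hsup : 𝒥.sup id = K) :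
    k + 1 ≤ #𝒥 := by
  have h := card_sup_le_mul 𝒥 h𝒥
  simp only [levelIndex, mem_filter, mem_univ, true_and] at hK
  rw [hsup] at h
  by_contra hlt
  have := Nat.mul_le_mul_right r (show #𝒥 ≤ k by omega)
  omega

/-- The members of a cover of `K ∈ 𝒬_k` by `k + 1` sets of size at most `r` are logical qubits. -/
theorem subset_qubitIndex_of_cover {k : ℕ} {K : Finset (Fin m)} (hK : K ∈ levelIndex m q r k)
    {𝒥 : Finset (Finset (Fin m))} (h𝒥 : ∀ J ∈ 𝒥, #J ≤ r) (hsup : 𝒥.sup id = K)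
    (hcard : #𝒥 = k + 1) : 𝒥 ⊆ qubitIndex m q r := by
  intro J hJ
  simp only [qubitIndex, mem_filter, mem_univ, true_and]
  refine ⟨?_, h𝒥 J hJ⟩
  simp only [levelIndex, mem_filter, mem_univ, true_and] at hK
  -- The other `k` members cover at most `k * r` points, leaving at least `q + 1` for `J`.
  have h1 := card_sup_le_mul (𝒥.erase J) fun J' hJ' => h𝒥 J' (Finset.mem_of_mem_erase hJ')
  have h2 : K = J ∪ (𝒥.erase J).sup id := by
    rw [← hsup, ← Finset.insert_erase hJ, Finset.sup_insert, Finset.insert_erase hJ]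
    rfl
  have h3 := Finset.card_union_le J ((𝒥.erase J).sup id)
  rw [← h2] at h3
  rw [Finset.card_erase_of_mem hJ, hcard, Nat.add_sub_cancel] at h1
  omega

theorem signedZ_phase {k : ℕ} {K : Finset (Fin m)} (hK : K ∈ levelIndex m q r k) {f : Config m}
    (hf : f ∈ reedMuller m r) :
    Complex.exp (Complex.I * Real.pi / 2 ^ k *
      (∑ s ∈ K.powerset, (-1 : ℤ) ^ #s * (f (incidence s) : ℕ) : ℤ)) =
    ∏ 𝒥 ∈ minimalCovers m q r k K, if 𝒥 ≠ ∅ ∧ 𝒥 ⊆ anfSupport f then -1 else 1 := by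
  have hle {𝒥 : Finset (Finset (Fin m))} (h : 𝒥 ⊆ anfSupport f) : ∀ J ∈ 𝒥, #J ≤ r :=
    fun J hJ => card_le_of_mem_anfSupport hf (h hJ)
  obtain ⟨c, hc⟩ := exists_alternating_sum_eq (fun s => (f (incidence s) : ℕ)) (anfSupport f) K
    (nonempty_of_mem_levelIndex hK) k (val_incidence_mul_two f)
    fun 𝒥 h𝒥 hsup => succ_le_card_of_sup_eq hK (hle h𝒥) hsup
  have hcovers : (minimalCovers m q r k K).filter (fun 𝒥 => 𝒥 ≠ ∅ ∧ 𝒥 ⊆ anfSupport f) =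
      (anfSupport f).powerset.filter fun 𝒥 => 𝒥.sup id = K ∧ #𝒥 = k + 1 := by
    ext 𝒥
    simp only [minimalCovers, mem_filter, mem_powerset]
    constructor
    · exact fun h => ⟨h.2.2, h.1.2⟩
    · refine fun h => ⟨⟨subset_qubitIndex_of_cover hK (hle h.1) h.2.1 h.2.2, h.2⟩, ?_, h.1⟩
      rintro rfl
      simp at h
  rw [hc, Finset.prod_ite, Finset.prod_const, Finset.prod_const_one, mul_one, hcovers]
  generalize #{𝒥 ∈ (anfSupport f).powerset | 𝒥.sup id = K ∧ #𝒥 = k + 1} = n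
  -- The factor `2^k` cancels the denominator: each minimal cover gives a half turn, and `c` counts
  -- full turns.
  have harg : Complex.I * Real.pi / 2 ^ k * ((2 ^ k * ((n : ℤ) + 2 * c) : ℤ) : ℂ) =
      (n : ℂ) * (Real.pi * Complex.I) + c * (2 * Real.pi * Complex.I) := by
    have : (2 : ℂ) ^ k ≠ 0 := pow_ne_zero k two_ne_zero
    push_cast
    field_simp
  rw [harg, Complex.exp_add, Complex.exp_int_mul_two_pi_mul_I, mul_one, Complex.exp_nat_mul,
    Complex.exp_pi_mul_I]

/-! ### Code states and undetectable errors -/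

/-- The states supported on the Reed--Muller code of order `r`. -/
def IsSupported (r : ℕ) (ψ : State m) : Prop := ∀ f ∉ reedMuller m r, ψ f = 0

theorem mem_codeSpace_iff {ψ : State m} : ψ ∈ codeSpace m q r ↔ IsSupported r ψ ∧
    ∀ (x : Cube m) (J : Finset (Fin m)), #J + q = m → ∀ f, ψ (flip (subcube x J) f) = ψ f := by
  constructor
  · intro h
    constructor
    · intro f hf
      simp only [reedMuller, Set.mem_ofPred_eq, not_forall] at hf
      obtain ⟨x, J, hJ, hp⟩ := hf
      have h1 := congrFun (h _ (Or.inr ⟨x, J, hJ, rfl⟩)) f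
      rw [opZ_eq_diagonal, Matrix.mulVec_diagonal, if_neg hp] at h1
      linear_combination (-1 / 2 : ℂ) * h1
    · intro x J hJ f
      have h1 := congrFun (h _ (Or.inl ⟨x, J, hJ, rfl⟩)) f
      rwa [opX_mulVec] at h1
  · rintro ⟨h1, h2⟩ P (⟨x, J, hJ, rfl⟩ | ⟨x, J, hJ, rfl⟩)
    · funext f
      rw [opX_mulVec, h2 x J hJ]
    · funext f
      rw [opZ_eq_diagonal, Matrix.mulVec_diagonal]
      by_cases hf : f ∈ reedMuller m r
      · rw [if_pos (hf x J hJ), one_mul]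
      · rw [h1 f hf, mul_zero]

theorem IsSupported.diagonal_mulVec {ψ : State m} (hψ : IsSupported r ψ) (d : Config m → ℂ) :
    IsSupported r ((Matrix.diagonal d).mulVec ψ) := by
  intro f hf
  rw [Matrix.mulVec_diagonal, hψ f hf, mul_zero]

theorem IsSupported.opX_mulVec {ψ : State m} (hψ : IsSupported r ψ) (x : Cube m)
    (J : Finset (Fin m)) (hJ : m ≤ #J + r) : IsSupported r ((opX (subcube x J)).mulVec ψ) := by
  intro f hf
  rw [QRM.opX_mulVec]
  refine hψ _ fun h => hf ?_
  rw [← flip_flip (subcube x J) f]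
  exact flip_mem_reedMuller x J hJ h

/-- Diagonal factors never enlarge the support. The `X` factors flip cubes of dimension `m - q` or
`m - #J` with `#J ≤ r`; as `q ≤ r`, both are at least `m - r`, so these flips preserve the
Reed–Muller code. -/
theorem IsSupported.undetectable_mulVec (hqr : q ≤ r) {P : Op m}
    (hP : P ∈ undetectablePaulis m q r) {ψ : State m} (hψ : IsSupported r ψ) :
    IsSupported r (P.mulVec ψ) := by
  induction hP using Submonoid.closure_induction generalizing ψ with
  | mem P hP =>
    rcases hP with (⟨x, J, hJ, rfl⟩ | ⟨x, J, hJ, rfl⟩) | ⟨J, hJ, rfl | rfl⟩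
    · exact hψ.opX_mulVec x J (by omega)
    · rw [opZ_eq_diagonal]
      exact hψ.diagonal_mulVec _
    · rw [logicalZ, opZ_eq_diagonal]
      exact hψ.diagonal_mulVec _
    · refine hψ.opX_mulVec _ _ ?_
      simp only [qubitIndex, mem_filter, mem_univ, true_and] at hJ
      rw [Finset.card_compl, Fintype.card_fin]
      omega
  | one => rwa [Matrix.one_mulVec]
  | mul P Q _ _ hP hQ =>
    rw [← Matrix.mulVec_mulVec]
    exact hP (hQ hψ)

theorem IsSupported.diagonal_mulVec_congr {ψ : State m} (hψ : IsSupported r ψ)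
    {d d' : Config m → ℂ} (h : ∀ f ∈ reedMuller m r, d f = d' f) :
    (Matrix.diagonal d).mulVec ψ = (Matrix.diagonal d').mulVec ψ := by
  funext f
  rw [Matrix.mulVec_diagonal, Matrix.mulVec_diagonal]
  by_cases hf : f ∈ reedMuller m r
  · rw [h f hf]
  · rw [hψ f hf, mul_zero, mul_zero]

/-- Diagonal operators that agree on the Reed--Muller code are logically equivalent. -/
theorem logicallyEquivalent_diagonal (hqr : q ≤ r) {d d' : Config m → ℂ}
    (h : ∀ f ∈ reedMuller m r, d f = d' f) :
    LogicallyEquivalent m q r (Matrix.diagonal d) (Matrix.diagonal d') where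
  action ψ hψ := (mem_codeSpace_iff.1 hψ).1.diagonal_mulVec_congr h
  conj P hP ψ hψ := by
    have hs := (mem_codeSpace_iff.1 hψ).1
    simp only [Matrix.diagonal_conjTranspose, ← Matrix.mulVec_mulVec]
    rw [hs.diagonal_mulVec_congr (d := star d) (d' := star d') fun f hf => congrArg star (h f hf)]
    -- The error `P` leaves the state supported where the two diagonals agree, so they can be
    -- exchanged a second time.
    exact ((hs.diagonal_mulVec _).undetectable_mulVec hqr hP).diagonal_mulVec_congr h

/-- The circuit's phase depends only on parities over cubes of dimension at least `q + 1`. These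
meet every `(m - q)`-cube evenly, so `X` stabilizers do not change the phase. -/
theorem logicalCircuit_mulVec_mem_codeSpace (ℱ : Finset (Finset (Finset (Fin m))))
    (hℱ : ∀ 𝒥 ∈ ℱ, 𝒥 ⊆ qubitIndex m q r) {ψ : State m} (hψ : ψ ∈ codeSpace m q r) :
    (logicalCircuit ℱ).mulVec ψ ∈ codeSpace m q r := by
  rw [mem_codeSpace_iff] at hψ ⊢
  rw [logicalCircuit_eq_diagonal]
  refine ⟨hψ.1.diagonal_mulVec _, fun x J hJ f => ?_⟩
  have hmem {J' : Finset (Fin m)} (hJ' : J' ∈ qubitIndex m q r) :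
      J' ∈ anfSupport (flip (subcube x J) f) ↔ J' ∈ anfSupport f := by
    simp only [qubitIndex, mem_filter, mem_univ, true_and] at hJ'
    have h := parity_flip_subcube 0 x J' J (by omega) f
    rw [mem_anfSupport, mem_anfSupport, stdCube, h]
  have hiff (𝒥) (h𝒥 : 𝒥 ∈ ℱ) : 𝒥 ⊆ anfSupport (flip (subcube x J) f) ↔ 𝒥 ⊆ anfSupport f :=
    ⟨fun h J' hJ' => (hmem (hℱ 𝒥 h𝒥 hJ')).1 (h hJ'),
      fun h J' hJ' => (hmem (hℱ 𝒥 h𝒥 hJ')).2 (h hJ')⟩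
  have hphase : (∏ 𝒥 ∈ ℱ, if 𝒥 ≠ ∅ ∧ 𝒥 ⊆ anfSupport (flip (subcube x J) f) then (-1 : ℂ) else 1) =
      ∏ 𝒥 ∈ ℱ, if 𝒥 ≠ ∅ ∧ 𝒥 ⊆ anfSupport f then (-1 : ℂ) else 1 :=
    Finset.prod_congr rfl fun 𝒥 h𝒥 => if_congr (and_congr_right' (hiff 𝒥 h𝒥)) rfl rfl
  rw [Matrix.mulVec_diagonal, Matrix.mulVec_diagonal, hψ.2 x J hJ, hphase]

end QRM

end

theorem mainTheorem7 (m q r : ℕ) (hqr : q ≤ r) (hrm : r ≤ m) (ℓ : ℕ) (k : Fin ℓ → ℕ)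
    (K : Fin ℓ → Finset (Fin m)) (hK : ∀ i, K i ∈ QRM.levelIndex m q r (k i))
    (hinj : Function.Injective K) (ℱ : Finset (Finset (Finset (Fin m))))
    (hℱ : ℱ = Finset.univ.biUnion fun i => QRM.minimalCovers m q r (k i) (K i)) :
    QRM.LogicallyEquivalent m q r
        (List.ofFn fun i => QRM.signedZ (k i) (QRM.stdCube (K i))).prod
        (QRM.logicalCircuit ℱ) ∧
      (∀ ψ ∈ QRM.codeSpace m q r,
        (List.ofFn fun i => QRM.signedZ (k i) (QRM.stdCube (K i))).prod.mulVec ψ ∈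
          QRM.codeSpace m q r) ∧
      ∀ 𝒥 ∈ ℱ, ∃! i, 𝒥 ∈ QRM.minimalCovers m q r (k i) (K i) := by
  subst hℱ
  have hunique {𝒥 : Finset (Finset (Fin m))} {i j : Fin ℓ}
      (hi : 𝒥 ∈ QRM.minimalCovers m q r (k i) (K i))
      (hj : 𝒥 ∈ QRM.minimalCovers m q r (k j) (K j)) : i = j :=
    -- A cover determines the covered set as its union.
    hinj ((Finset.mem_filter.1 hi).2.1.symm.trans (Finset.mem_filter.1 hj).2.1)
  have hequiv : QRM.LogicallyEquivalent m q r
      (List.ofFn fun i => QRM.signedZ (k i) (QRM.stdCube (K i))).prod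
      (QRM.logicalCircuit
        (Finset.univ.biUnion fun i => QRM.minimalCovers m q r (k i) (K i))) := by
    have hprod (d : Fin ℓ → QRM.Config m → ℂ) :
        (List.ofFn fun i => Matrix.diagonal (d i)).prod = Matrix.diagonal (∏ i, d i) := by
      have h := map_list_prod (Matrix.diagonalRingHom (QRM.Config m) ℂ) (List.ofFn d)
      rw [List.prod_ofFn, List.map_ofFn] at h
      exact h.symm
    simp only [QRM.signedZ_eq_diagonal]
    rw [hprod, QRM.logicalCircuit_eq_diagonal]
    refine QRM.logicallyEquivalent_diagonal hqr fun f hf => ?_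
    rw [Finset.prod_biUnion, Finset.prod_apply]
    · exact Finset.prod_congr rfl fun i _ => QRM.signedZ_phase (hK i) hf
    · intro i _ j _ hij
      exact Finset.disjoint_left.2 fun 𝒥 hi hj => hij (hunique hi hj)
  refine ⟨hequiv, fun ψ hψ => ?_, fun 𝒥 h𝒥 => ?_⟩
  -- Invariance of the code space is read off from the circuit, which acts identically on code
  -- states.
  · rw [hequiv.action ψ hψ]
    refine QRM.logicalCircuit_mulVec_mem_codeSpace _ (fun 𝒥 h𝒥 => ?_) hψ
    obtain ⟨i, -, hi⟩ := Finset.mem_biUnion.1 h𝒥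
    exact Finset.mem_powerset.1 (Finset.mem_filter.1 hi).1
  · obtain ⟨i, -, hi⟩ := Finset.mem_biUnion.1 h𝒥
    exact ⟨i, hi, fun j hj => hunique hj hi⟩
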